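/- Graphs are simple, possibly infinite, and every edge is identified with the interval $[0,1]$, so that a graph $G$ (vertices together with the points of its edges) carries the path distance $d_G\in[0,\infty]$, with $d_G=\infty$ between different connected components. A geodesic triangle $T$ in $G$ consists of three points and three geodesics joining them in pairs; $T$ is $\delta$-thin if each of its three sides is contained in the $\delta$-neighbourhood of the union of the other two, and $\delta(T)$ is the infimum of the $\delta\ge 0$ for which $T$ is $\delta$-thin. Put $\delta(G):=\sup_T\delta(T)\in[0,\infty]$, the supremum over all geodesic triangles of $G$ (if $G$ is not connected, this is the supremum of the constants of its connected components). Let $\operatorname{diam}V(G):=\sup\{d_G(u,v): u,v\in V(G)\}\in[0,\infty]$. The direct product $G_1\times G_2$ has vertex set $V(G_1)\times V(G_2)$, and $(u_1,v_1)$, $(u_2,v_2)$ are adjacent if and only if $u_1u_2\in E(G_1)$ and $v_1v_2\in E(G_2)$. Theorem. Let $G_1$ and $G_2$ be connected bipartite graphs, and let $k_1:=\operatorname{diam}V(G_1)$ and $k_2:=\operatorname{diam}V(G_2)$ satisfy $k_1\ge k_2\ge 1$ (infinite values are allowed, with the usual conventions). Then $$\max\Big\{\min\Big\{\frac{k_1-1}{2},\,k_2-1\Big\},\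 \delta(G_1),\ \delta(G_2)\Big\}\ \le\ \delta(G_1\times G_2)\ \le\ \frac{k_1}{2}.$$ Furthermore, if $k_1\le 2k_2-2$ and $k_1$ is a (finite) even integer, then $\delta(G_1\times G_2)=k_1/2$. -/

import Mathlib

open scoped ENNReal

/-! ### Geodesic triangles and the sharp hyperbolicity constant -/

/-- `S` is (the image of) a geodesic joining `x` to `y`: a curve `γ : [a, b] → X` with
`d(γ(s), γ(t)) = |s - t|`. (The length of such a restricted curve is automatically `|s - t|`.) -/
def IsGeodesicBetween {X : Type*} [PseudoEMetricSpace X] (x y : X) (S : Set X) : Prop :=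
  ∃ (γ : ℝ → X) (a b : ℝ), a ≤ b ∧
    (∀ s ∈ Set.Icc a b, ∀ t ∈ Set.Icc a b, edist (γ s) (γ t) = ENNReal.ofReal |s - t|) ∧
    γ a = x ∧ γ b = y ∧ γ '' Set.Icc a b = S

/-- A geodesic triangle: three points and a choice of three geodesics joining them. -/
structure GeodesicTriangle (X : Type*) [PseudoEMetricSpace X] where
  x₁ : X
  x₂ : X
  x₃ : X
  side₁₂ : Set X
  side₂₃ : Set X
  side₃₁ : Set X
  geodesic₁₂ : IsGeodesicBetween x₁ x₂ side₁₂
  geodesic₂₃ : IsGeodesicBetween x₂ x₃ side₂₃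
  geodesic₃₁ : IsGeodesicBetween x₃ x₁ side₃₁

/-- `T` is `δ`-thin: each side lies in the `δ`-neighbourhood of the union of the other two. -/
def GeodesicTriangle.IsThin {X : Type*} [PseudoEMetricSpace X] (T : GeodesicTriangle X)
    (δ : ℝ≥0∞) : Prop :=
  (∀ p ∈ T.side₁₂, Metric.infEDist p (T.side₂₃ ∪ T.side₃₁) ≤ δ) ∧
  (∀ p ∈ T.side₂₃, Metric.infEDist p (T.side₃₁ ∪ T.side₁₂) ≤ δ) ∧
  (∀ p ∈ T.side₃₁, Metric.infEDist p (T.side₁₂ ∪ T.side₂₃) ≤ δ)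

/-- The sharp thin constant `δ(T)`. -/
noncomputable def GeodesicTriangle.thinConst {X : Type*} [PseudoEMetricSpace X]
    (T : GeodesicTriangle X) : ℝ≥0∞ :=
  sInf {δ : ℝ≥0∞ | T.IsThin δ}

/-- The sharp hyperbolicity constant `δ(X) = sup_T δ(T)`, in `[0, ∞]`. In an extended metric space
all points of a geodesic triangle are at finite distance from each other. Hence, when `X` is the
disjoint union of geodesic components at infinite distance from each other, this is the supremum
of the hyperbolicity constants of the components. -/
noncomputable def hyperbolicityConst (X : Type*) [PseudoEMetricSpace X] : ℝ≥0∞ :=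
  ⨆ T : GeodesicTriangle X, T.thinConst

namespace SimpleGraph

/-! ### Direct product -/

/-- The direct (tensor) product of graphs. -/
def directProd {V₁ V₂ : Type*} (G₁ : SimpleGraph V₁) (G₂ : SimpleGraph V₂) :
    SimpleGraph (V₁ × V₂) where
  Adj x y := G₁.Adj x.1 y.1 ∧ G₂.Adj x.2 y.2
  symm := ⟨fun _ _ h => ⟨h.1.symm, h.2.symm⟩⟩
  loopless := ⟨fun _ h => G₁.loopless.irrefl _ h.1⟩

/-! ### The metric graph: every edge is a copy of `[0, 1]` -/

/-- The vertex `u`, in barycentric coordinates. -/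
noncomputable def bary {V : Type*} (u : V) : V → ℝ :=
  open scoped Classical in Pi.single u 1

/-- `x` is a vertex, or lies on an edge, and `u` is that vertex, or an endpoint of that edge.
(If `u` is an endpoint of an edge containing `x`, then the distance from `x` to `u` along that edge
is `1 - x u`.) -/
def IsEndOf {V : Type*} (G : SimpleGraph V) (u : V) (x : V → ℝ) : Prop :=
  x = bary u ∨ ∃ a, G.Adj u a ∧ x ∈ segment ℝ (bary u) (bary a)

/-- The points of `G` regarded as a metric graph, in barycentric coordinates: the vertices,
and the points `(1 - t) u + t v`, `t ∈ [0, 1]`, of the edges `[u, v]`. -/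
def MetricGraph {V : Type*} (G : SimpleGraph V) : Type _ :=
  {x : V → ℝ // ∃ u, G.IsEndOf u x}

namespace MetricGraph

variable {V : Type*} {G : SimpleGraph V}

/-- Length of the arc of an edge joining `x` to `y`, if `x` and `y` lie on a common edge `[a, b]`
(and `∞` otherwise). -/
noncomputable def edgeDist (x y : G.MetricGraph) : ℝ≥0∞ :=
  ⨅ (a : V) (b : V) (_ : G.Adj a b ∧ x.1 ∈ segment ℝ (bary a) (bary b) ∧
    y.1 ∈ segment ℝ (bary a) (bary b)), ENNReal.ofReal |x.1 a - y.1 a|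

/-- Length of a shortest path from `x` to `y` of the following kind: from `x` along its edge to an
endpoint `u`, then along edges of `G` to an endpoint `v` of the edge of `y`, and then to `y`. -/
noncomputable def pathDist (x y : G.MetricGraph) : ℝ≥0∞ :=
  ⨅ (u : V) (v : V) (_ : G.IsEndOf u x.1 ∧ G.IsEndOf v y.1),
    ENNReal.ofReal (1 - x.1 u) + (G.edist u v : ℝ≥0∞) + ENNReal.ofReal (1 - y.1 v)

theorem bary_self (u : V) : bary u u = 1 := by simp [bary]

theorem bary_ne {u w : V} (h : w ≠ u) : bary u w = 0 := by simp [bary, h]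

theorem mem_seg {a b : V} (hab : a ≠ b) {x : V → ℝ} (h : x ∈ segment ℝ (bary a) (bary b)) :
    0 ≤ x a ∧ 0 ≤ x b ∧ x a + x b = 1 ∧ ∀ w, w ≠ a → w ≠ b → x w = 0 := by
  obtain ⟨s, t, hs, ht, hst, rfl⟩ := h
  refine ⟨?_, ?_, ?_, fun w h1 h2 => ?_⟩ <;>
    simp [bary_self, bary_ne, hab.symm, *]

theorem IsEndOf.bound {u : V} {x : V → ℝ} (h : G.IsEndOf u x) :
    0 ≤ x u ∧ x u ≤ 1 ∧ ∀ w, w ≠ u → 0 ≤ x w ∧ x w ≤ 1 - x u := by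
  rcases h with rfl | ⟨a, ha, hx⟩
  · refine ⟨by simp [bary_self], by simp [bary_self], fun w hw => ?_⟩
    simp [bary_self, bary_ne hw]
  · obtain ⟨h1, h2, h3, h4⟩ := mem_seg ha.ne hx
    refine ⟨h1, by linarith, fun w hw => ?_⟩
    by_cases hwa : w = a
    · subst hwa; constructor <;> linarith
    · rw [h4 w hw hwa]; constructor <;> linarith

theorem eq_bary {a b : V} (hab : a ≠ b) {x : V → ℝ} (h : x ∈ segment ℝ (bary a) (bary b))
    (h1 : x a = 1) : x = bary a := by
  obtain ⟨-, -, h3, h4⟩ := mem_seg hab h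
  funext w
  by_cases hwa : w = a
  · subst hwa; rw [h1, bary_self]
  · rw [bary_ne hwa]
    by_cases hwb : w = b
    · subst hwb; linarith
    · exact h4 w hwa hwb

/-- Two ends `v`, `v'` of `y`, where `v ≠ v'`: adjacent, or `y` is a vertex. -/
theorem IsEndOf.cases {v v' : V} {y : V → ℝ} (h : G.IsEndOf v y) (h' : G.IsEndOf v' y)
    (hne : v ≠ v') :
    (G.Adj v v' ∧ y v + y v' ≤ 1) ∨ (y v = 0 ∧ y v' = 0 ∧ ∃ a, G.Adj v a ∧ G.Adj a v') := by
  rcases h with rfl | ⟨a, ha, hy⟩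
  · rcases h' with h' | ⟨b, hb, hy'⟩
    · have := congrFun h' v
      rw [bary_self, bary_ne hne] at this; norm_num at this
    · obtain ⟨h1, h2, h3, h4⟩ := mem_seg hb.ne hy'
      by_cases hvb : v = b
      · subst hvb; left; exact ⟨hb.symm, by linarith⟩
      · have := h4 v hne hvb
        rw [bary_self] at this; norm_num at this
  · obtain ⟨h1, h2, h3, h4⟩ := mem_seg ha.ne hy
    by_cases hva : v' = a
    · subst hva; left; exact ⟨ha, by linarith⟩
    have h0 := h4 v' hne.symm hva
    rcases h' with rfl | ⟨b, hb, hy'⟩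
    · rw [bary_self] at h0; norm_num at h0
    · obtain ⟨k1, k2, k3, k4⟩ := mem_seg hb.ne hy'
      by_cases hvb : v = b
      · subst hvb; left; exact ⟨hb.symm, by linarith⟩
      · right
        have hv0 := k4 v hne hvb
        refine ⟨hv0, h0, a, ha, ?_⟩
        by_cases hab : a = b
        · subst hab; exact hb.symm
        · have := k4 a (Ne.symm hva) hab
          linarith

/-- The distance between two ends of `y` is at most the length of the path through `y`. -/
theorem IsEndOf.edist_le {v v' : V} {y : V → ℝ} (h : G.IsEndOf v y) (h' : G.IsEndOf v' y) :
    (G.edist v v' : ℝ≥0∞) ≤ ENNReal.ofReal (1 - y v) + ENNReal.ofReal (1 - y v') := by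
  by_cases hne : v = v'
  · subst hne; simp
  rw [← ENNReal.ofReal_add (by linarith [(IsEndOf.bound h).2.1])
    (by linarith [(IsEndOf.bound h').2.1])]
  rcases IsEndOf.cases h h' hne with ⟨hadj, hle⟩ | ⟨h0, h0', a, ha, ha'⟩
  · rw [edist_eq_one_iff_adj.2 hadj, ENat.toENNReal_one, ← ENNReal.ofReal_one]
    exact ENNReal.ofReal_le_ofReal (by linarith)
  · have h2 : G.edist v v' ≤ 1 + 1 := by
      calc G.edist v v' ≤ G.edist v a + G.edist a v' := SimpleGraph.edist_triangle
        _ = 1 + 1 := by rw [edist_eq_one_iff_adj.2 ha, edist_eq_one_iff_adj.2 ha']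
    have h3 : (G.edist v v' : ℝ≥0∞) ≤ 1 + 1 := by
      have := ENat.toENNReal_le.2 h2
      simpa using this
    refine h3.trans (le_of_eq ?_)
    rw [h0, h0', ENNReal.ofReal_add (by norm_num) (by norm_num)]; simp

/-- Transport of an end of `y` to an end of `z` when `y`, `z` are on a common edge. -/
theorem transport {a b v : V} {y z : V → ℝ} (hab : G.Adj a b)
    (hy : y ∈ segment ℝ (bary a) (bary b)) (hz : z ∈ segment ℝ (bary a) (bary b))
    (hv : G.IsEndOf v y) :
    ∃ v', G.IsEndOf v' z ∧ (G.edist v v' : ℝ≥0∞) + ENNReal.ofReal (1 - z v') ≤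
      ENNReal.ofReal (1 - y v) + ENNReal.ofReal |y a - z a| := by
  have key : ∀ c d : V, G.Adj c d → y ∈ segment ℝ (bary c) (bary d) →
      z ∈ segment ℝ (bary c) (bary d) → |y a - z a| = |y c - z c| → (v = c ∨ y c = 1) →
      ∃ v', G.IsEndOf v' z ∧ (G.edist v v' : ℝ≥0∞) + ENNReal.ofReal (1 - z v') ≤
      ENNReal.ofReal (1 - y v) + ENNReal.ofReal |y a - z a| := by
    intro c d hcd hyc hzc habs hor
    refine ⟨c, Or.inr ⟨d, hcd, hzc⟩, ?_⟩
    rw [habs]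
    rcases hor with rfl | h1
    · rw [SimpleGraph.edist_self, ENat.toENNReal_zero, zero_add,
        ← ENNReal.ofReal_add (by linarith [(IsEndOf.bound hv).2.1]) (abs_nonneg _)]
      exact ENNReal.ofReal_le_ofReal (by linarith [le_abs_self (y v - z v)])
    · refine add_le_add ?_ ?_
      · have := IsEndOf.edist_le hv (v' := c) (Or.inr ⟨d, hcd, hyc⟩)
        simpa [h1] using this
      · rw [h1]; exact ENNReal.ofReal_le_ofReal (le_abs_self _)
  obtain ⟨h1, h2, h3, h4⟩ := mem_seg hab.ne hy
  obtain ⟨k1, k2, k3, k4⟩ := mem_seg hab.ne hz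
  have hsymm : |y a - z a| = |y b - z b| := by
    rw [show y a - z a = -(y b - z b) by linarith, abs_neg]
  have hy' := hy
  have hz' := hz
  rw [segment_symm] at hy' hz'
  by_cases hva : v = a
  · exact key a b hab hy hz rfl (Or.inl hva)
  by_cases hvb : v = b
  · exact key b a hab.symm hy' hz' hsymm (Or.inl hvb)
  rcases hv with rfl | ⟨c, hc, hyc⟩
  · have := h4 v hva hvb
    rw [bary_self] at this; norm_num at this
  · obtain ⟨m1, m2, m3, m4⟩ := mem_seg hc.ne hyc
    have hv0 := h4 v hva hvb
    by_cases hca : c = a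
    · subst hca
      exact key c b hab hy hz rfl (Or.inr (by linarith))
    by_cases hcb : c = b
    · subst hcb
      exact key c a hab.symm hy' hz' hsymm (Or.inr (by linarith))
    · have := h4 c hca hcb
      linarith

theorem edgeDist_comm (x y : G.MetricGraph) : edgeDist x y = edgeDist y x := by
  refine iInf_congr fun a => iInf_congr fun b => ?_
  rw [abs_sub_comm]
  exact iInf_congr_Prop (by tauto) fun _ => rfl

theorem pathDist_comm (x y : G.MetricGraph) : pathDist x y = pathDist y x := by
  unfold pathDist
  rw [iInf_comm]
  refine iInf_congr fun a => iInf_congr fun b => iInf_congr_Prop (by tauto) fun _ => ?_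
  rw [SimpleGraph.edist_comm]; ring

theorem pathDist_le {x y : G.MetricGraph} {u v : V} (hu : G.IsEndOf u x.1)
    (hv : G.IsEndOf v y.1) : pathDist x y ≤
      ENNReal.ofReal (1 - x.1 u) + (G.edist u v : ℝ≥0∞) + ENNReal.ofReal (1 - y.1 v) :=
  (iInf_le _ u).trans ((iInf_le _ v).trans (iInf_le _ ⟨hu, hv⟩))

theorem edgeDist_le {x y : G.MetricGraph} {a b : V} (hab : G.Adj a b)
    (hx : x.1 ∈ segment ℝ (bary a) (bary b)) (hy : y.1 ∈ segment ℝ (bary a) (bary b)) :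
    edgeDist x y ≤ ENNReal.ofReal |x.1 a - y.1 a| :=
  (iInf_le _ a).trans ((iInf_le _ b).trans (iInf_le _ ⟨hab, hx, hy⟩))

theorem path_triangle (x y z : G.MetricGraph) : pathDist x z ≤ pathDist x y + pathDist y z := by
  conv_rhs => simp only [pathDist, ENNReal.iInf_add, ENNReal.add_iInf]
  refine le_iInf fun v' => le_iInf fun w => le_iInf fun h' => le_iInf fun u => le_iInf fun v =>
    le_iInf fun h => ?_
  refine (pathDist_le h.1 h'.2).trans ?_
  have h1 : (G.edist u w : ℝ≥0∞) ≤ G.edist u v + (G.edist v v' + G.edist v' w) := by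
    have : G.edist u w ≤ G.edist u v + (G.edist v v' + G.edist v' w) :=
      SimpleGraph.edist_triangle.trans (add_le_add le_rfl SimpleGraph.edist_triangle)
    simpa using ENat.toENNReal_le.2 this
  have h2 := IsEndOf.edist_le h.2 h'.1
  calc _ ≤ ENNReal.ofReal (1 - x.1 u) + (G.edist u v + ((ENNReal.ofReal (1 - y.1 v) +
          ENNReal.ofReal (1 - y.1 v')) + G.edist v' w)) + ENNReal.ofReal (1 - z.1 w) := by
        gcongr; exact h1.trans (by gcongr)
    _ = _ := by ring

theorem path_edge_triangle (x y z : G.MetricGraph) :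
    pathDist x z ≤ pathDist x y + edgeDist y z := by
  simp only [pathDist, edgeDist, ENNReal.iInf_add, ENNReal.add_iInf]
  refine le_iInf fun a => le_iInf fun b => le_iInf fun h' => le_iInf fun u => le_iInf fun v =>
    le_iInf fun h => ?_
  obtain ⟨v', hv', hle⟩ := transport h'.1 h'.2.1 h'.2.2 h.2
  refine (pathDist_le h.1 hv').trans ?_
  have h1 : (G.edist u v' : ℝ≥0∞) ≤ G.edist u v + G.edist v v' := by
    have : G.edist u v' ≤ G.edist u v + G.edist v v' := SimpleGraph.edist_triangle
    simpa using ENat.toENNReal_le.2 this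
  calc _ ≤ ENNReal.ofReal (1 - x.1 u) + (G.edist u v + G.edist v v') +
          ENNReal.ofReal (1 - z.1 v') := by gcongr
    _ = ENNReal.ofReal (1 - x.1 u) + G.edist u v + (G.edist v v' +
          ENNReal.ofReal (1 - z.1 v')) := by ring
    _ ≤ ENNReal.ofReal (1 - x.1 u) + G.edist u v + (ENNReal.ofReal (1 - y.1 v) +
          ENNReal.ofReal |y.1 a - z.1 a|) := by gcongr
    _ = _ := by ring

theorem side {a b e : V} {x y : V → ℝ} (hab : G.Adj a b)
    (hx : x ∈ segment ℝ (bary a) (bary b)) (hy : y ∈ segment ℝ (bary a) (bary b))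
    (he : y e = 1) : G.IsEndOf e x ∧ 1 - x e = |x a - y a| := by
  obtain ⟨h1, h2, h3, h4⟩ := mem_seg hab.ne hx
  obtain ⟨k1, k2, k3, k4⟩ := mem_seg hab.ne hy
  by_cases hea : e = a
  · subst hea
    refine ⟨Or.inr ⟨b, hab, hx⟩, ?_⟩
    rw [he, abs_sub_comm, abs_of_nonneg (by linarith)]
  by_cases heb : e = b
  · subst heb
    refine ⟨Or.inr ⟨a, hab.symm, segment_symm ℝ (bary a) (bary e) ▸ hx⟩, ?_⟩
    rw [abs_of_nonneg (by linarith)]; linarith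
  · have := k4 e hea heb
    linarith

theorem edge_triangle (x y z : G.MetricGraph) :
    min (edgeDist x z) (pathDist x z) ≤ edgeDist x y + edgeDist y z := by
  conv_rhs => simp only [edgeDist, ENNReal.iInf_add, ENNReal.add_iInf]
  refine le_iInf fun c => le_iInf fun d => le_iInf fun h' => le_iInf fun a => le_iInf fun b =>
    le_iInf fun h => ?_
  obtain ⟨hab, hx, hy⟩ := h
  obtain ⟨hcd, hy', hz⟩ := h'
  by_cases hve : ∃ e, y.1 e = 1
  · obtain ⟨e, he⟩ := hve
    obtain ⟨e1, e2⟩ := side hab hx hy he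
    obtain ⟨f1, f2⟩ := side hcd hz hy' he
    refine (min_le_right _ _).trans ((pathDist_le e1 f1).trans ?_)
    rw [e2, f2, SimpleGraph.edist_self, ENat.toENNReal_zero, add_zero,
      abs_sub_comm (z.1 c) (y.1 c)]
  · push Not at hve
    obtain ⟨k1, k2, k3, k4⟩ := mem_seg hab.ne hy
    obtain ⟨m1, m2, m3, m4⟩ := mem_seg hcd.ne hy'
    have hc : c = a ∨ c = b := by
      by_contra! hcon
      have := k4 c hcon.1 hcon.2
      exact hve d (by linarith)
    have hd : d = a ∨ d = b := by
      by_contra! hcon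
      have := k4 d hcon.1 hcon.2
      exact hve c (by linarith)
    have main : ∀ z' : G.MetricGraph, z'.1 ∈ segment ℝ (bary a) (bary b) →
        min (edgeDist x z') (pathDist x z') ≤
          ENNReal.ofReal |x.1 a - y.1 a| + ENNReal.ofReal |y.1 a - z'.1 a| := by
      intro z' hz'
      refine (min_le_left _ _).trans ((edgeDist_le hab hx hz').trans ?_)
      rw [← ENNReal.ofReal_add (abs_nonneg _) (abs_nonneg _)]
      exact ENNReal.ofReal_le_ofReal (abs_sub_le _ _ _)
    rcases hc with rfl | rfl
    · rcases hd with rfl | rfl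
      · exact absurd rfl hcd.ne
      · exact main z hz
    · rcases hd with rfl | rfl
      · have hz' := segment_symm ℝ (bary c) (bary d) ▸ hz
        have e : |y.1 c - z.1 c| = |y.1 d - z.1 d| := by
          obtain ⟨-, -, n3, -⟩ := mem_seg hcd.ne hz
          rw [show y.1 c - z.1 c = -(y.1 d - z.1 d) by linarith, abs_neg]
        rw [e]
        exact main z hz'
      · exact absurd rfl hcd.ne

/-- The distance is at least the difference of any coordinate. -/
theorem coord_le (x y : G.MetricGraph) (w : V) :
    ENNReal.ofReal |x.1 w - y.1 w| ≤ min (edgeDist x y) (pathDist x y) := by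
  refine le_min ?_ ?_
  · refine le_iInf fun a => le_iInf fun b => le_iInf fun h => ENNReal.ofReal_le_ofReal ?_
    obtain ⟨hab, hx, hy⟩ := h
    obtain ⟨h1, h2, h3, h4⟩ := mem_seg hab.ne hx
    obtain ⟨k1, k2, k3, k4⟩ := mem_seg hab.ne hy
    by_cases hwa : w = a
    · rw [hwa]
    by_cases hwb : w = b
    · rw [hwb, show x.1 b - y.1 b = -(x.1 a - y.1 a) by linarith, abs_neg]
    · rw [h4 w hwa hwb, k4 w hwa hwb]; simp
  · refine le_iInf fun u => le_iInf fun v => le_iInf fun h => ?_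
    obtain ⟨h1, h2, h3⟩ := IsEndOf.bound h.1
    obtain ⟨k1, k2, k3⟩ := IsEndOf.bound h.2
    by_cases huv : u = v
    · subst huv
      rw [SimpleGraph.edist_self, ENat.toENNReal_zero, add_zero,
        ← ENNReal.ofReal_add (by linarith) (by linarith)]
      refine ENNReal.ofReal_le_ofReal (abs_le.2 ?_)
      by_cases hw : w = u
      · subst hw; constructor <;> linarith
      · have := h3 w hw
        have := k3 w hw
        constructor <;> linarith
    · have e1 : (1 : ℝ≥0∞) ≤ G.edist u v := by
        have : (1 : ℕ∞) ≤ G.edist u v := Order.one_le_iff_pos.2 (SimpleGraph.edist_pos_of_ne huv)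
        simpa using ENat.toENNReal_le.2 this
      have hxw : 0 ≤ x.1 w ∧ x.1 w ≤ 1 := by
        by_cases hw : w = u
        · subst hw; constructor <;> linarith
        · have := h3 w hw
          constructor <;> linarith
      have hyw : 0 ≤ y.1 w ∧ y.1 w ≤ 1 := by
        by_cases hw : w = v
        · subst hw; constructor <;> linarith
        · have := k3 w hw
          constructor <;> linarith
      calc ENNReal.ofReal |x.1 w - y.1 w| ≤ ENNReal.ofReal 1 :=
            ENNReal.ofReal_le_ofReal (abs_le.2 (by constructor <;> linarith))
        _ = 1 := ENNReal.ofReal_one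
        _ ≤ G.edist u v := e1
        _ ≤ _ := le_add_right (le_add_left le_rfl)

/-- The natural (path) distance of the metric graph `G`; it is `∞` between different connected
components. -/
noncomputable instance : EMetricSpace G.MetricGraph where
  edist x y := min (edgeDist x y) (pathDist x y)
  edist_self x := by
    refine le_antisymm ?_ zero_le
    obtain ⟨u, hu | ⟨a, ha, hx⟩⟩ := x.2
    · refine (min_le_right _ _).trans ((pathDist_le (Or.inl hu) (Or.inl hu)).trans ?_)
      simp [hu, bary_self]
    · refine (min_le_left _ _).trans ((edgeDist_le ha hx hx).trans ?_)
      simp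
  edist_comm x y := by rw [edgeDist_comm, pathDist_comm]
  edist_triangle x y z := by
    rcases min_choice (edgeDist x y) (pathDist x y) with h | h <;>
      rcases min_choice (edgeDist y z) (pathDist y z) with h' | h' <;> rw [h, h']
    · exact edge_triangle x y z
    · rw [pathDist_comm x z, edgeDist_comm x y, pathDist_comm y z, add_comm]
      exact (min_le_right _ _).trans (path_edge_triangle z y x)
    · exact (min_le_right _ _).trans (path_edge_triangle x y z)
    · exact (min_le_right _ _).trans (path_triangle x y z)
  eq_of_edist_eq_zero {x y} h := by
    refine Subtype.ext (funext fun w => ?_)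
    have := (coord_le x y w).trans (le_of_eq h)
    rw [nonpos_iff_eq_zero, ENNReal.ofReal_eq_zero] at this
    linarith [abs_nonpos_iff.1 this]

theorem edist_def (x y : G.MetricGraph) :
    EDist.edist x y = min (edgeDist x y) (pathDist x y) := rfl

end MetricGraph

/-- The sharp hyperbolicity constant `δ(G)` of the graph `G`, regarded as a metric graph. -/
noncomputable def hyperbolicityConst {V : Type*} (G : SimpleGraph V) : ℝ≥0∞ :=
  _root_.hyperbolicityConst G.MetricGraph

end SimpleGraph

/-! ### Geodesics and the thin constant in extended metric spaces -/

section Abstract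

variable {X Y : Type*} [PseudoEMetricSpace X] [PseudoEMetricSpace Y] {x y : X} {S : Set X}

/-! Upper bound: a point of a side is within half the side's length of one of its ends, and both
ends lie on the other two sides, so the constant is at most half the largest finite distance. That
distance is at most `k₁`, by parity used twice. Within a component of the product the projections of
a common walk have equal length, so shortest walks in the two factors have the same parity;
backtracking pads the shorter one, and the product distance is at most the larger factor distance
(`edist_directProd_le`). In a bipartite graph, passing from vertices to interior points of edges
does not raise the diameter (`MetricGraph.edist_le_of_coloring`).

Lower bounds: a 2-colouring of one factor, with an edge of the other, gives a section of the
projection. Both maps are homomorphisms, hence 1-Lipschitz, so the factor embeds isometrically and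
its triangles keep their thin constants. The remaining bound comes from a bigon: over a geodesic of
length `2r` in `G₁`, one walk climbs a geodesic of length `r + 1` in `G₂` and returns, while the
other oscillates on its first edge. The summit is at distance at least `r` from the second walk.
Choosing `r` optimally under `2r ≤ k₁` and `r + 1 ≤ k₂` gives the minimum in the theorem, and gives
`k₁/2` in the even case. -/

theorem IsGeodesicBetween.left_mem (h : IsGeodesicBetween x y S) : x ∈ S := by
  obtain ⟨γ, a, b, hab, -, rfl, -, rfl⟩ := h
  exact ⟨a, ⟨le_rfl, hab⟩, rfl⟩

theorem IsGeodesicBetween.right_mem (h : IsGeodesicBetween x y S) : y ∈ S := by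
  obtain ⟨γ, a, b, hab, -, -, rfl, rfl⟩ := h
  exact ⟨b, ⟨hab, le_rfl⟩, rfl⟩

theorem IsGeodesicBetween.refl (x : X) : IsGeodesicBetween x x {x} :=
  ⟨fun _ => x, 0, 0, le_rfl, by
    rintro s ⟨h1, h2⟩ t ⟨h3, h4⟩
    obtain rfl : s = 0 := le_antisymm h2 h1
    obtain rfl : t = 0 := le_antisymm h4 h3
    simp, rfl, rfl, by simp⟩

theorem IsGeodesicBetween.symm (h : IsGeodesicBetween x y S) : IsGeodesicBetween y x S := by
  obtain ⟨γ, a, b, hab, hγ, rfl, rfl, rfl⟩ := h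
  refine ⟨fun t => γ (-t), -b, -a, by linarith, fun s hs t ht => ?_, by simp, by simp, ?_⟩
  · rw [hγ _ ⟨by linarith [hs.2], by linarith [hs.1]⟩ _ ⟨by linarith [ht.2], by linarith [ht.1]⟩,
      show -s - -t = -(s - t) by ring, abs_neg]
  · rw [← Set.image_image γ (fun t => -t), Set.image_neg_eq_neg, Set.neg_Icc, neg_neg, neg_neg]

theorem IsGeodesicBetween.image {f : X → Y} (hf : Isometry f) (h : IsGeodesicBetween x y S) :
    IsGeodesicBetween (f x) (f y) (f '' S) := by
  obtain ⟨γ, a, b, hab, hγ, rfl, rfl, rfl⟩ := h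
  exact ⟨f ∘ γ, a, b, hab, fun s hs t ht => (hf _ _).trans (hγ s hs t ht), rfl, rfl,
    Set.image_comp f γ _⟩

theorem IsGeodesicBetween.edist_ne_top (h : IsGeodesicBetween x y S) : edist x y ≠ ∞ := by
  obtain ⟨γ, a, b, hab, hγ, rfl, rfl, -⟩ := h
  rw [hγ a ⟨le_rfl, hab⟩ b ⟨hab, le_rfl⟩]
  exact ENNReal.ofReal_ne_top

theorem IsGeodesicBetween.edist_add_edist (h : IsGeodesicBetween x y S) {p : X} (hp : p ∈ S) :
    edist p x + edist p y = edist x y := by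
  obtain ⟨γ, a, b, hab, hγ, rfl, rfl, rfl⟩ := h
  obtain ⟨t, ht, rfl⟩ := hp
  have ha : a ∈ Set.Icc a b := ⟨le_rfl, hab⟩
  have hb : b ∈ Set.Icc a b := ⟨hab, le_rfl⟩
  rw [hγ t ht a ha, hγ t ht b hb, hγ a ha b hb,
    ← ENNReal.ofReal_add (abs_nonneg _) (abs_nonneg _), abs_of_nonneg (sub_nonneg.2 ht.1),
    abs_of_nonpos (sub_nonpos.2 ht.2), abs_of_nonpos (sub_nonpos.2 hab)]
  congr 1
  ring

/-- The image of a geodesic triangle under an isometric embedding. -/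
def GeodesicTriangle.map {f : X → Y} (hf : Isometry f) (T : GeodesicTriangle X) :
    GeodesicTriangle Y :=
  ⟨f T.x₁, f T.x₂, f T.x₃, f '' T.side₁₂, f '' T.side₂₃, f '' T.side₃₁,
    T.geodesic₁₂.image hf, T.geodesic₂₃.image hf, T.geodesic₃₁.image hf⟩

theorem GeodesicTriangle.isThin_map {f : X → Y} (hf : Isometry f) (T : GeodesicTriangle X)
    (δ : ℝ≥0∞) : (T.map hf).IsThin δ ↔ T.IsThin δ := by
  simp only [GeodesicTriangle.IsThin, GeodesicTriangle.map, Set.forall_mem_image,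
    ← Set.image_union, Metric.infEDist_image hf]

/-- Images of geodesics are geodesics and distances to sets are preserved, so a triangle keeps its
thin constant; the image need not be convex. -/
theorem hyperbolicityConst_le_of_isometry {f : X → Y} (hf : Isometry f) :
    hyperbolicityConst X ≤ hyperbolicityConst Y := by
  refine iSup_le fun T => le_iSup_of_le (T.map hf) ?_
  simp only [GeodesicTriangle.thinConst, T.isThin_map hf, le_refl]

/-- The distances from `p` to the two ends add up to at most `k`, so they cannot both exceed `k /
2`. -/
theorem IsGeodesicBetween.infEDist_le {k : ℝ≥0∞} (h : IsGeodesicBetween x y S)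
    (hk : edist x y ≤ k) {U : Set X} (hx : x ∈ U) (hy : y ∈ U) {p : X} (hp : p ∈ S) :
    Metric.infEDist p U ≤ k / 2 := by
  have h1 := h.edist_add_edist hp
  by_contra! hlt
  have h2 := hlt.trans_le (Metric.infEDist_le_edist_of_mem (x := p) hx)
  have h3 := hlt.trans_le (Metric.infEDist_le_edist_of_mem (x := p) hy)
  have h4 := ENNReal.add_lt_add h2 h3
  rw [ENNReal.add_halves, h1] at h4
  exact absurd hk h4.not_ge

theorem hyperbolicityConst_le_half {k : ℝ≥0∞}
    (h : ∀ a b : X, edist a b ≠ ∞ → edist a b ≤ k) : hyperbolicityConst X ≤ k / 2 := by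
  refine iSup_le fun T => sInf_le ⟨fun p hp => ?_, fun p hp => ?_, fun p hp => ?_⟩
  · exact T.geodesic₁₂.infEDist_le (h _ _ T.geodesic₁₂.edist_ne_top)
      (Or.inr T.geodesic₃₁.right_mem) (Or.inl T.geodesic₂₃.left_mem) hp
  · exact T.geodesic₂₃.infEDist_le (h _ _ T.geodesic₂₃.edist_ne_top)
      (Or.inr T.geodesic₁₂.right_mem) (Or.inl T.geodesic₃₁.left_mem) hp
  · exact T.geodesic₃₁.infEDist_le (h _ _ T.geodesic₃₁.edist_ne_top)
      (Or.inr T.geodesic₂₃.right_mem) (Or.inl T.geodesic₁₂.left_mem) hp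

/-- A geodesic bigon gives a lower bound for the hyperbolicity constant. -/
theorem le_hyperbolicityConst_of_bigon {S' : Set X} {r : ℝ≥0∞} (h : IsGeodesicBetween x y S)
    (h' : IsGeodesicBetween x y S') {p : X} (hp : p ∈ S) (hr : ∀ q ∈ S', r ≤ edist p q) :
    r ≤ hyperbolicityConst X := by
  -- The bigon is a triangle with a repeated vertex `y`; its constant side lies in `S'`, so only
  -- `S'` has to be far from `p`.
  refine le_iSup_of_le ⟨x, y, y, S, {y}, S', h, .refl y, h'.symm⟩ (le_sInf fun δ hδ => ?_)
  refine le_trans ?_ (hδ.1 p hp)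
  refine Metric.le_infEDist.2 fun q hq => hr q ?_
  rcases hq with hq | hq
  · rw [Set.mem_singleton_iff.1 hq]
    exact h'.right_mem
  · exact hq

end Abstract

namespace SimpleGraph

/-! ### Walks and distances in direct products -/

section Walks

variable {V V₁ V₂ W : Type*} {G : SimpleGraph V} {H : SimpleGraph W}
  {G₁ : SimpleGraph V₁} {G₂ : SimpleGraph V₂}

theorem edist_map_le (f : G →g H) (u v : V) : H.edist (f u) (f v) ≤ G.edist u v := by
  by_cases h : G.edist u v = ⊤
  · rw [h]; exact le_top
  obtain ⟨p, hp⟩ := exists_walk_of_edist_ne_top h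
  rw [← hp, ← Walk.length_map f p]
  exact edist_le _

/-- The first projection of a direct product. -/
def directProdFst (G₁ : SimpleGraph V₁) (G₂ : SimpleGraph V₂) : G₁.directProd G₂ →g G₁ :=
  ⟨Prod.fst, fun h => h.1⟩

/-- The second projection of a direct product. -/
def directProdSnd (G₁ : SimpleGraph V₁) (G₂ : SimpleGraph V₂) : G₁.directProd G₂ →g G₂ :=
  ⟨Prod.snd, fun h => h.2⟩

/-- Every edge of the product moves both coordinates, so two walks can be paired step by step
exactly when their lengths agree. -/
theorem exists_directProd_walk {u₁ w₁ : V₁} (p : G₁.Walk u₁ w₁) :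
    ∀ {u₂ w₂ : V₂} (q : G₂.Walk u₂ w₂), p.length = q.length →
      ∃ s : (G₁.directProd G₂).Walk (u₁, u₂) (w₁, w₂), s.length = p.length := by
  induction p with
  | nil =>
    intro u₂ w₂ q h
    cases q with
    | nil => exact ⟨.nil, rfl⟩
    | cons _ _ => simp at h
  | cons h1 p ih =>
    intro u₂ w₂ q h
    cases q with
    | nil => simp at h
    | cons h2 q =>
      obtain ⟨s, hs⟩ := ih q (by simpa using h)
      exact ⟨Walk.cons ⟨h1, h2⟩ s, congrArg (· + 1) hs⟩

/-- Bouncing along the edge `u a` before setting out adds two steps each time. -/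
theorem Walk.exists_length_add_two_mul {u w a : V} (h : G.Adj u a) (p : G.Walk u w) (j : ℕ) :
    ∃ q : G.Walk u w, q.length = p.length + 2 * j := by
  induction j with
  | zero => exact ⟨p, rfl⟩
  | succ j ih =>
    obtain ⟨q, hq⟩ := ih
    exact ⟨.cons h (.cons h.symm q), by simp [hq]; ring⟩

theorem edist_directProd_le (hc : G₁.Coloring Bool) (hc' : G₂.Coloring Bool)
    (hn : ∀ u, ∃ a, G₁.Adj u a) (hn' : ∀ u, ∃ a, G₂.Adj u a) {x y : V₁ × V₂} {k : ℕ∞}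
    (hxy : (G₁.directProd G₂).Reachable x y) (h1 : G₁.edist x.1 y.1 ≤ k)
    (h2 : G₂.edist x.2 y.2 ≤ k) : (G₁.directProd G₂).edist x y ≤ k := by
  obtain ⟨s⟩ := hxy
  obtain ⟨p, hp⟩ : ∃ p : G₁.Walk x.1 y.1, (p.length : ℕ∞) = G₁.edist x.1 y.1 :=
    (s.map (directProdFst G₁ G₂)).reachable.exists_walk_length_eq_edist
  obtain ⟨q, hq⟩ : ∃ q : G₂.Walk x.2 y.2, (q.length : ℕ∞) = G₂.edist x.2 y.2 :=
    (s.map (directProdSnd G₁ G₂)).reachable.exists_walk_length_eq_edist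
  rw [← hp] at h1
  rw [← hq] at h2
  -- In a bipartite graph the ends fix the parity of a walk, so `p` and `q` both have the parity of
  -- `s`.
  have e1 := (hc.even_length_iff_congr p).trans
    (hc.even_length_iff_congr (s.map (directProdFst G₁ G₂))).symm
  have e2 := (hc'.even_length_iff_congr q).trans
    (hc'.even_length_iff_congr (s.map (directProdSnd G₁ G₂))).symm
  rw [Walk.length_map] at e1 e2
  have e := e1.trans e2.symm
  rw [Nat.even_iff, Nat.even_iff] at e
  obtain ⟨a, ha⟩ := hn x.1
  obtain ⟨a', ha'⟩ := hn' x.2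
  rcases le_total p.length q.length with hle | hle
  · obtain ⟨p', hp'⟩ := p.exists_length_add_two_mul ha ((q.length - p.length) / 2)
    obtain ⟨t, ht⟩ := exists_directProd_walk p' q (by omega)
    refine (edist_le t).trans (le_trans ?_ h2)
    exact_mod_cast (show t.length ≤ q.length by omega)
  · obtain ⟨q', hq'⟩ := q.exists_length_add_two_mul ha' ((p.length - q.length) / 2)
    obtain ⟨t, ht⟩ := exists_directProd_walk p q' (by omega)
    exact (edist_le t).trans (by rw [ht]; exact h1)

/-- A connected graph contains a geodesic with any number of edges up to the diameter. -/
theorem Connected.exists_geodesic (hc : G.Connected) {n : ℕ} (hn : (n : ℕ∞) ≤ G.ediam) :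
    ∃ g : ℕ → V, (∀ i < n, G.Adj (g i) (g (i + 1))) ∧
      ∀ i ≤ n, ∀ j ≤ n, i ≤ j → G.edist (g i) (g j) = (j - i : ℕ) := by
  obtain ⟨u, v, huv⟩ : ∃ u v, (n : ℕ∞) ≤ G.edist u v := by
    rcases Nat.eq_zero_or_pos n with rfl | hpos
    · obtain ⟨u⟩ := hc.nonempty
      exact ⟨u, u, by simp⟩
    -- The diameter may be infinite and not attained; if all distances were below `n`, it would be
    -- at most `n - 1`.
    by_contra! hcon
    have : G.ediam ≤ (n - 1 : ℕ) := ediam_le_of_edist_le fun u v => by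
      have := hcon u v
      rw [← Nat.sub_add_cancel hpos] at this
      exact Order.le_of_lt_add_one (by exact_mod_cast this)
    have := hn.trans this
    norm_cast at this
    omega
  obtain ⟨p, hp⟩ := hc.exists_walk_length_eq_edist u v
  rw [← hp] at huv
  have hnp : n ≤ p.length := by exact_mod_cast huv
  have up : ∀ d i : ℕ, G.edist (p.getVert i) (p.getVert (i + d)) ≤ d := by
    intro d
    induction d with
    | zero => intro i; simp
    | succ d ih =>
      intro i
      refine (SimpleGraph.edist_triangle (v := p.getVert (i + d))).trans ?_
      rw [Nat.cast_succ]
      refine add_le_add (ih i) ?_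
      by_cases h : i + d < p.length
      · exact (edist_eq_one_iff_adj.2 (p.adj_getVert_succ h)).le
      -- Past its end, `getVert` stays at the last vertex, so `up` needs no range restriction.
      · rw [← add_assoc, p.getVert_of_length_le (by omega), p.getVert_of_length_le (by omega)]
        simp
  refine ⟨p.getVert, fun i hi => p.adj_getVert_succ (by omega), fun i hi j hj hij => ?_⟩
  obtain ⟨d, rfl⟩ := Nat.exists_eq_add_of_le hij
  rw [Nat.add_sub_cancel_left]
  refine le_antisymm (up d i) ?_
  -- A shortcut between positions `i` and `i + d` would shorten the whole walk, which is already
  -- shortest.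
  have h1 := up i 0
  rw [zero_add, p.getVert_zero] at h1
  have h2 := up (p.length - (i + d)) (i + d)
  rw [show i + d + (p.length - (i + d)) = p.length by omega, p.getVert_length] at h2
  have h3 : (p.length : ℕ∞) ≤ i + (G.edist (p.getVert i) (p.getVert (i + d)) +
      (p.length - (i + d) : ℕ)) := by
    rw [hp]
    refine SimpleGraph.edist_triangle.trans (add_le_add h1 ?_)
    exact SimpleGraph.edist_triangle.trans (add_le_add le_rfl h2)
  have h4 := up d i
  lift G.edist (p.getVert i) (p.getVert (i + d)) to ℕ using
    ne_top_of_le_ne_top (ENat.natCast_ne_top d) h4 with e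
  norm_cast at h3 ⊢
  omega

theorem edist_le_of_adj {n : ℕ} {w : ℕ → V} (hw : ∀ i < n, G.Adj (w i) (w (i + 1)))
    {i j : ℕ} (hij : i ≤ j) (hj : j ≤ n) : G.edist (w i) (w j) ≤ (j - i : ℕ) := by
  induction j, hij using Nat.le_induction with
  | base => simp
  | succ j hij ih =>
    refine (SimpleGraph.edist_triangle (v := w j)).trans ?_
    rw [Nat.succ_sub hij, Nat.cast_succ]
    exact add_le_add (ih (by omega)) (edist_eq_one_iff_adj.2 (hw j (by omega))).le

end Walks

end SimpleGraph

namespace SimpleGraph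

namespace MetricGraph

variable {V W : Type*} {G : SimpleGraph V} {H : SimpleGraph W}

/-! ### Functoriality of the metric graph -/

section Map

/-- The push-forward of barycentric coordinates along a map of vertices. -/
noncomputable def push (f : V → W) (x : V → ℝ) : W → ℝ :=
  fun w => ∑ᶠ v, x v * bary (f v) w

theorem push_bary (f : V → W) (u : V) : push f (bary u) = bary (f u) := by
  funext w
  rw [push, finsum_eq_single _ u fun v hv => by rw [bary_ne hv, zero_mul], bary_self, one_mul]

theorem push_of_mem_segment (f : V → W) {a b : V} (hab : a ≠ b) {x : V → ℝ}
    (hx : x ∈ segment ℝ (bary a) (bary b)) :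
    push f x = x a • bary (f a) + x b • bary (f b) := by
  classical
  funext w
  obtain ⟨-, -, -, h⟩ := mem_seg hab hx
  rw [push, finsum_eq_sum_of_support_subset (s := {a, b}), Finset.sum_pair hab]
  · rfl
  · intro v hv
    by_contra hcon
    simp only [Finset.coe_insert, Finset.coe_singleton, Set.mem_insert_iff,
      Set.mem_singleton_iff, not_or] at hcon
    exact hv (by simp [h v hcon.1 hcon.2])

theorem push_mem_segment (f : V → W) {a b : V} (hab : a ≠ b) {x : V → ℝ}
    (hx : x ∈ segment ℝ (bary a) (bary b)) :
    push f x ∈ segment ℝ (bary (f a)) (bary (f b)) := by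
  obtain ⟨h1, h2, h3, -⟩ := mem_seg hab hx
  exact ⟨x a, x b, h1, h2, h3, (push_of_mem_segment f hab hx).symm⟩

/-- A homomorphism of simple graphs never collapses an edge, so `f a` receives weight from `a`
alone. -/
theorem push_apply_left (f : G →g H) {a b : V} (hab : G.Adj a b) {x : V → ℝ}
    (hx : x ∈ segment ℝ (bary a) (bary b)) : push f x (f a) = x a := by
  rw [push_of_mem_segment f hab.ne hx]
  simp [bary_self, bary_ne (f.map_adj hab).ne]

theorem IsEndOf.push (f : G →g H) {u : V} {x : V → ℝ} (h : G.IsEndOf u x) :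
    H.IsEndOf (f u) (push f x) ∧ MetricGraph.push f x (f u) = x u := by
  rcases h with rfl | ⟨a, ha, hx⟩
  · rw [push_bary, bary_self, bary_self]
    exact ⟨Or.inl rfl, rfl⟩
  · exact ⟨Or.inr ⟨f a, f.map_adj ha, push_mem_segment f ha.ne hx⟩, push_apply_left f ha hx⟩

/-- The map of metric graphs induced by a graph homomorphism. -/
noncomputable def map (f : G →g H) (x : G.MetricGraph) : H.MetricGraph :=
  ⟨push f x.1, let ⟨u, hu⟩ := x.2; ⟨f u, (IsEndOf.push f hu).1⟩⟩

theorem edist_map_le (f : G →g H) (x y : G.MetricGraph) :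
    EDist.edist (map f x) (map f y) ≤ EDist.edist x y := by
  rw [edist_def, edist_def]
  refine min_le_min ?_ ?_
  · refine le_iInf fun a => le_iInf fun b => le_iInf fun h => ?_
    refine (edgeDist_le (f.map_adj h.1) (push_mem_segment f h.1.ne h.2.1)
      (push_mem_segment f h.1.ne h.2.2)).trans ?_
    simp only [map, push_apply_left f h.1 h.2.1, push_apply_left f h.1 h.2.2, le_refl]
  · refine le_iInf fun u => le_iInf fun v => le_iInf fun h => ?_
    obtain ⟨hu, hu'⟩ := IsEndOf.push f h.1
    obtain ⟨hv, hv'⟩ := IsEndOf.push f h.2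
    refine (pathDist_le hu hv).trans ?_
    simp only [map, hu', hv']
    gcongr
    exact SimpleGraph.edist_map_le f u v

theorem map_map_of_leftInverse (f : G →g H) (g : H →g G) (hgf : ∀ v, g (f v) = v)
    (x : G.MetricGraph) : map g (map f x) = x := by
  refine Subtype.ext ?_
  change push g (push f x.1) = x.1
  obtain ⟨u, hu | ⟨a, ha, hx⟩⟩ := x.2
  · rw [hu, push_bary, push_bary, hgf]
  · have hfa := f.map_adj ha
    rw [push_of_mem_segment g hfa.ne (push_mem_segment f ha.ne hx), push_apply_left f ha hx,
      push_apply_left f ha.symm (segment_symm ℝ (bary u) (bary a) ▸ hx), hgf, hgf]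
    obtain ⟨-, -, -, h⟩ := mem_seg ha.ne hx
    funext w
    by_cases hwu : w = u
    · subst hwu; simp [bary_self, bary_ne ha.ne]
    by_cases hwa : w = a
    · subst hwa; simp [bary_self, bary_ne ha.ne.symm]
    · simp [bary_ne hwu, bary_ne hwa, h w hwu hwa]

/-- Both induced maps are 1-Lipschitz and compose to the identity, so neither loses distance on the
image of `map f`. -/
theorem isometry_map_of_leftInverse (f : G →g H) (g : H →g G) (hgf : ∀ v, g (f v) = v) :
    Isometry (map f) := fun x y => by
  refine le_antisymm (edist_map_le f x y) ?_
  conv_lhs => rw [← map_map_of_leftInverse f g hgf x, ← map_map_of_leftInverse f g hgf y]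
  exact edist_map_le g _ _

end Map

/-! ### Distances to vertices -/

section Vert

/-- A vertex as a point of the metric graph. -/
noncomputable def vert (G : SimpleGraph V) (v : V) : G.MetricGraph := ⟨bary v, v, Or.inl rfl⟩

theorem pathDist_vert_le_edgeDist (v : V) (y : G.MetricGraph) :
    pathDist (vert G v) y ≤ edgeDist (vert G v) y := by
  refine le_iInf fun a => le_iInf fun b => le_iInf fun h => ?_
  obtain ⟨h1, h2⟩ := side h.1 h.2.2 h.2.1 (bary_self v)
  refine (pathDist_le (Or.inl rfl) h1).trans ?_
  rw [h2, abs_sub_comm]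
  simp [vert, bary_self]

/-- The metric also allows a path to start at a neighbour of `v`, at cost 1; the triangle inequality
reduces this to starting at `v`. -/
theorem le_edist_vert {v : V} {y : G.MetricGraph} {r : ℝ≥0∞}
    (h : ∀ w, G.IsEndOf w y.1 → r ≤ G.edist v w + ENNReal.ofReal (1 - y.1 w)) :
    r ≤ EDist.edist (vert G v) y := by
  rw [edist_def, min_eq_right (pathDist_vert_le_edgeDist v y)]
  refine le_iInf fun u => le_iInf fun w => le_iInf fun huw => (h w huw.2).trans ?_
  refine add_le_add ?_ le_rfl
  have h1 := IsEndOf.edist_le (G := G) (v := v) (y := bary v) (Or.inl rfl) huw.1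
  rw [bary_self, sub_self, ENNReal.ofReal_zero, zero_add] at h1
  have h2 : (G.edist v w : ℝ≥0∞) ≤ G.edist v u + G.edist u w := by
    rw [← ENat.toENNReal_add]
    exact ENat.toENNReal_le.2 SimpleGraph.edist_triangle
  exact h2.trans (add_le_add h1 le_rfl)

theorem le_edist_vert_vert (v w : V) : (G.edist v w : ℝ≥0∞) ≤ EDist.edist (vert G v) (vert G w) := by
  refine le_edist_vert fun u hu => ?_
  have h1 := IsEndOf.edist_le (G := G) hu (v' := w) (Or.inl rfl)
  have h2 : (G.edist v w : ℝ≥0∞) ≤ G.edist v u + G.edist u w := by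
    rw [← ENat.toENNReal_add]
    exact ENat.toENNReal_le.2 SimpleGraph.edist_triangle
  refine h2.trans (add_le_add le_rfl (h1.trans ?_))
  simp [vert, bary_self]

theorem le_edist_vert_of_mem_segment {v a b : V} (hab : G.Adj a b) {y : G.MetricGraph}
    (hy : y.1 ∈ segment ℝ (bary a) (bary b)) {r : ℕ∞} (ha : r ≤ G.edist v a)
    (hb : r ≤ G.edist v b) : (r : ℝ≥0∞) ≤ EDist.edist (vert G v) y := by
  refine le_edist_vert fun w hw => ?_
  obtain ⟨-, -, -, h4⟩ := mem_seg hab.ne hy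
  by_cases hwa : w = a
  · subst hwa; exact le_add_right (ENat.toENNReal_le.2 ha)
  by_cases hwb : w = b
  · subst hwb; exact le_add_right (ENat.toENNReal_le.2 hb)
  -- An end of `y` off the edge `a b` forces `y` to be a vertex, namely `a` or `b`, adjacent to `w`;
  -- the unit cost from `w` makes up the difference.
  have hw0 := h4 w hwa hwb
  rcases hw with hw | ⟨c, hc, hyc⟩
  · rw [hw, bary_self] at hw0; norm_num at hw0
  obtain ⟨-, -, k3, -⟩ := mem_seg hc.ne hyc
  have hrc : r ≤ G.edist v c := by
    by_cases hca : c = a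
    · rwa [hca]
    by_cases hcb : c = b
    · rwa [hcb]
    have := h4 c hca hcb
    linarith
  rw [hw0, sub_zero, ENNReal.ofReal_one, ← ENat.toENNReal_one, ← ENat.toENNReal_add,
    ← edist_eq_one_iff_adj.2 hc]
  exact ENat.toENNReal_le.2 (hrc.trans SimpleGraph.edist_triangle)

end Vert

/-! ### Geodesics along walks -/

section Walks

/-- `x` is the point at time `t` on the unit speed curve through `w 0, …, w n`. -/
def IsWalkPoint (w : ℕ → V) (n : ℕ) (t : ℝ) (x : V → ℝ) : Prop :=
  ∃ i < n, (i : ℝ) ≤ t ∧ t ≤ i + 1 ∧ x = (1 - (t - i)) • bary (w i) + (t - i) • bary (w (i + 1))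

variable {w : ℕ → V} {n : ℕ}

theorem exists_isWalkPoint (hw : ∀ i < n, G.Adj (w i) (w (i + 1))) (hn : 0 < n) {t : ℝ}
    (ht : t ∈ Set.Icc (0 : ℝ) n) : ∃ x : G.MetricGraph, IsWalkPoint w n t x.1 := by
  obtain ⟨i, hi, h1, h2⟩ : ∃ i < n, (i : ℝ) ≤ t ∧ t ≤ i + 1 := by
    -- The floor selects the edge, except at `t = n`, which belongs to the last edge.
    by_cases h : ⌊t⌋₊ < n
    · exact ⟨_, h, Nat.floor_le ht.1, (Nat.lt_floor_add_one t).le⟩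
    · have h' : (n : ℝ) ≤ t := (Nat.le_floor_iff ht.1).1 (not_lt.1 h)
      refine ⟨n - 1, by omega, ?_, ?_⟩
      · push_cast [Nat.one_le_iff_ne_zero.2 hn.ne']; linarith
      · push_cast [Nat.one_le_iff_ne_zero.2 hn.ne']; linarith [ht.2]
  exact ⟨⟨_, w i, Or.inr ⟨_, hw i hi, 1 - (t - i), t - i, by linarith, by linarith, by ring, rfl⟩⟩,
    i, hi, h1, h2, rfl⟩

theorem IsWalkPoint.natCast {i : ℕ} {x : V → ℝ} (h : IsWalkPoint w n i x) : x = bary (w i) := by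
  obtain ⟨j, hj, h1, h2, rfl⟩ := h
  have h1' : j ≤ i := by exact_mod_cast h1
  have h2' : i ≤ j + 1 := by exact_mod_cast h2
  rcases h1'.eq_or_lt with rfl | hlt
  · simp
  · obtain rfl : i = j + 1 := by omega
    simp

theorem edist_le_of_isWalkPoint (hw : ∀ i < n, G.Adj (w i) (w (i + 1))) {s t : ℝ} (hst : s ≤ t)
    {x y : G.MetricGraph} (hx : IsWalkPoint w n s x.1) (hy : IsWalkPoint w n t y.1) :
    EDist.edist x y ≤ ENNReal.ofReal (t - s) := by
  obtain ⟨i, hi, hi1, hi2, hx⟩ := hx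
  obtain ⟨j, hj, hj1, hj2, hy⟩ := hy
  have hxs : x.1 ∈ segment ℝ (bary (w i)) (bary (w (i + 1))) :=
    ⟨1 - (s - i), s - i, by linarith, by linarith, by ring, hx.symm⟩
  have hys : y.1 ∈ segment ℝ (bary (w j)) (bary (w (j + 1))) :=
    ⟨1 - (t - j), t - j, by linarith, by linarith, by ring, hy.symm⟩
  have hxi : x.1 (w i) = 1 - (s - i) := by
    rw [hx]; simp [bary_self, bary_ne (hw i hi).ne]
  have hxi' : x.1 (w (i + 1)) = s - i := by
    rw [hx]; simp [bary_self, bary_ne (hw i hi).ne.symm]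
  have hyj : y.1 (w j) = 1 - (t - j) := by
    rw [hy]; simp [bary_self, bary_ne (hw j hj).ne]
  have hyj' : y.1 (w (j + 1)) = t - j := by
    rw [hy]; simp [bary_self, bary_ne (hw j hj).ne.symm]
  rw [edist_def]
  rcases lt_trichotomy i j with hij | rfl | hij
  · refine (min_le_right _ _).trans ((pathDist_le (u := w (i + 1)) (v := w j)
      (Or.inr ⟨_, (hw i hi).symm, segment_symm ℝ (bary (w i)) (bary (w (i + 1))) ▸ hxs⟩)
      (Or.inr ⟨_, hw j hj, hys⟩)).trans ?_)
    have h1 := ENat.toENNReal_le.2 (edist_le_of_adj hw (show i + 1 ≤ j from hij) hj.le)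
    rw [ENat.toENNReal_coe, ← ENNReal.ofReal_natCast] at h1
    refine (add_le_add (add_le_add le_rfl h1) le_rfl).trans ?_
    rw [hxi', hyj, ← ENNReal.ofReal_add (by linarith) (by positivity),
      ← ENNReal.ofReal_add (by have : (0 : ℝ) ≤ (j - (i + 1) : ℕ) := by positivity
                               linarith) (by linarith)]
    refine ENNReal.ofReal_le_ofReal ?_
    push_cast [show i + 1 ≤ j from hij]
    linarith
  · refine (min_le_left _ _).trans ((edgeDist_le (hw i hi) hxs hys).trans ?_)
    rw [hxi, hyj, abs_of_nonneg (by linarith)]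
    exact ENNReal.ofReal_le_ofReal (by linarith)
  -- Since `s ≤ t`, this case occurs only when both points are the vertex shared by two consecutive
  -- edges.
  · have hij' : (j : ℝ) + 1 ≤ i := by exact_mod_cast hij
    obtain rfl : j + 1 = i := by
      have : (i : ℝ) ≤ j + 1 := by linarith
      have : i ≤ j + 1 := by exact_mod_cast this
      omega
    refine (min_le_right _ _).trans ((pathDist_le (u := w (j + 1)) (v := w (j + 1))
      (Or.inr ⟨_, hw _ hi, hxs⟩)
      (Or.inr ⟨_, (hw j hj).symm, segment_symm ℝ (bary (w j)) (bary (w (j + 1))) ▸ hys⟩)).trans ?_)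
    push_cast at *
    rw [hxi, hyj', show s = j + 1 by linarith, show t = j + 1 by linarith]
    simp

/-- A geodesic walk spans a geodesic of the metric graph. -/
theorem exists_isGeodesicBetween (hw : ∀ i < n, G.Adj (w i) (w (i + 1))) (hn : 0 < n)
    (hd : (n : ℕ∞) ≤ G.edist (w 0) (w n)) :
    ∃ S, IsGeodesicBetween (vert G (w 0)) (vert G (w n)) S ∧ (∀ i ≤ n, vert G (w i) ∈ S) ∧
      ∀ y ∈ S, ∃ i < n, y.1 ∈ segment ℝ (bary (w i)) (bary (w (i + 1))) := by
  have hex : ∀ t : ℝ, ∃ x : G.MetricGraph, t ∈ Set.Icc (0 : ℝ) n → IsWalkPoint w n t x.1 := by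
    intro t
    by_cases ht : t ∈ Set.Icc (0 : ℝ) n
    · obtain ⟨x, hx⟩ := exists_isWalkPoint hw hn ht
      exact ⟨x, fun _ => hx⟩
    · exact ⟨vert G (w 0), fun h => absurd h ht⟩
  choose γ hγ using hex
  have hv : ∀ i ≤ n, γ i = vert G (w i) := fun i hi =>
    Subtype.ext (hγ i ⟨by positivity, by exact_mod_cast hi⟩).natCast
  have h0 : γ 0 = vert G (w 0) := by simpa using hv 0 (Nat.zero_le n)
  have h0m : (0 : ℝ) ∈ Set.Icc (0 : ℝ) n := ⟨le_rfl, by positivity⟩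
  have hnm : (n : ℝ) ∈ Set.Icc (0 : ℝ) n := ⟨by positivity, le_rfl⟩
  have hle : ∀ s ∈ Set.Icc (0 : ℝ) n, ∀ t ∈ Set.Icc (0 : ℝ) n, s ≤ t →
      EDist.edist (γ s) (γ t) ≤ ENNReal.ofReal (t - s) := fun s hs t ht hst =>
    edist_le_of_isWalkPoint hw hst (hγ s hs) (hγ t ht)
  have hge : ENNReal.ofReal n ≤ EDist.edist (γ 0) (γ n) := by
    rw [h0, hv n le_rfl, ENNReal.ofReal_natCast, ← ENat.toENNReal_coe]
    exact (ENat.toENNReal_le.2 hd).trans (le_edist_vert_vert _ _)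
  have heq : ∀ s ∈ Set.Icc (0 : ℝ) n, ∀ t ∈ Set.Icc (0 : ℝ) n, s ≤ t →
      EDist.edist (γ s) (γ t) = ENNReal.ofReal (t - s) := by
    intro s hs t ht hst
    refine le_antisymm (hle s hs t ht hst) ?_
    -- The three pieces are no longer than their parameter intervals yet together reach `n`, so the
    -- middle one has full length.
    have h1 := hle 0 h0m s hs hs.1
    have h2 := hle t ht n hnm ht.2
    have h3 : ENNReal.ofReal n ≤ ENNReal.ofReal (s - 0) + EDist.edist (γ s) (γ t) +
        ENNReal.ofReal (n - t) :=
      hge.trans ((edist_triangle4 _ (γ s) (γ t) _).trans (by gcongr))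
    have h4 : EDist.edist (γ s) (γ t) ≠ ∞ := ne_top_of_le_ne_top ENNReal.ofReal_ne_top (hle s hs t ht hst)
    rw [← ENNReal.ofReal_toReal h4] at h3 ⊢
    rw [← ENNReal.ofReal_add (by linarith [hs.1]) ENNReal.toReal_nonneg,
      ← ENNReal.ofReal_add (by linarith [hs.1, ENNReal.toReal_nonneg (a := EDist.edist (γ s) (γ t))])
        (by linarith [ht.2]), ENNReal.ofReal_le_ofReal_iff (by
          linarith [hs.1, ht.2, ENNReal.toReal_nonneg (a := EDist.edist (γ s) (γ t))])] at h3
    exact ENNReal.ofReal_le_ofReal (by linarith)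
  refine ⟨γ '' Set.Icc 0 n, ⟨γ, 0, n, by positivity, fun s hs t ht => ?_, h0, hv n le_rfl, rfl⟩,
    fun i hi => ⟨i, ⟨by positivity, by exact_mod_cast hi⟩, hv i hi⟩, ?_⟩
  · rcases le_total s t with hst | hst
    · rw [heq s hs t ht hst, abs_sub_comm, abs_of_nonneg (by linarith)]
    · rw [PseudoEMetricSpace.edist_comm, heq t ht s hs hst, abs_of_nonneg (by linarith)]
  · rintro _ ⟨t, ht, rfl⟩
    obtain ⟨i, hi, h1, h2, hx⟩ := hγ t ht
    exact ⟨i, hi, 1 - (t - i), t - i, by linarith, by linarith, by ring, hx.symm⟩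

end Walks

end MetricGraph

end SimpleGraph

namespace SimpleGraph

/-! ### The diameter of a bipartite metric graph -/

section Bipartite

variable {V V₁ V₂ : Type*} {G : SimpleGraph V} {G₁ : SimpleGraph V₁} {G₂ : SimpleGraph V₂}

theorem Coloring.even_dist_iff (c : G.Coloring Bool) {u v : V} (h : G.Reachable u v) :
    Even (G.dist u v) ↔ c u = c v := by
  obtain ⟨p, hp⟩ := h.exists_walk_length_eq_dist
  rw [← hp, c.even_length_iff_congr p]
  exact Bool.eq_iff_iff.symm

theorem IsEndOf.exists_mem_segment (hn : ∀ u, ∃ a, G.Adj u a) {u : V} {x : V → ℝ}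
    (h : G.IsEndOf u x) : ∃ a, G.Adj u a ∧ x ∈ segment ℝ (bary u) (bary a) := by
  rcases h with rfl | h
  · obtain ⟨a, ha⟩ := hn u
    exact ⟨a, ha, left_mem_segment ℝ _ _⟩
  · exact h

namespace MetricGraph

theorem edist_le_of_isEndOf {x y : G.MetricGraph} {u v : V} (hu : G.IsEndOf u x.1)
    (hv : G.IsEndOf v y.1) (huv : G.Reachable u v) {k : ℝ}
    (h : 1 - x.1 u + G.dist u v + (1 - y.1 v) ≤ k) : EDist.edist x y ≤ ENNReal.ofReal k := by
  refine (min_le_right _ _).trans ((pathDist_le hu hv).trans ?_)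
  have h1 := (IsEndOf.bound hu).2.1
  have h2 := (IsEndOf.bound hv).2.1
  rw [← huv.coe_dist_eq_edist, ENat.toENNReal_coe, ← ENNReal.ofReal_natCast,
    ← ENNReal.ofReal_add (by linarith) (by positivity),
    ← ENNReal.ofReal_add (by linarith [(G.dist u v).cast_nonneg (α := ℝ)]) (by linarith)]
  exact ENNReal.ofReal_le_ofReal h

/-- Passing from the vertices to the points of the edges does not increase the diameter of a
bipartite graph. -/
theorem edist_le_of_coloring (c : G.Coloring Bool) (hn : ∀ u, ∃ a, G.Adj u a) {k : ℕ}
    (hk : ∀ u v, G.Reachable u v → G.edist u v ≤ k) {x y : G.MetricGraph}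
    (hxy : EDist.edist x y ≠ ∞) : EDist.edist x y ≤ k := by
  have hdist : ∀ u v, G.Reachable u v → G.dist u v ≤ k := fun u v h => by
    have := hk u v h
    rw [← h.coe_dist_eq_edist] at this
    exact_mod_cast this
  by_cases hE : edgeDist x y = ∞
  · have hP : pathDist x y ≠ ∞ := by rwa [edist_def, hE, min_eq_right le_top] at hxy
    obtain ⟨u, v, hu, hv, huv⟩ : ∃ u v, G.IsEndOf u x.1 ∧ G.IsEndOf v y.1 ∧ G.Reachable u v := by
      by_contra! hcon
      refine hP (iInf_eq_top.2 fun u => iInf_eq_top.2 fun v => iInf_eq_top.2 fun h => ?_)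
      rw [edist_eq_top_of_not_reachable (hcon u v h.1 h.2)]
      simp
    obtain ⟨a, ha, hx⟩ := hu.exists_mem_segment hn
    obtain ⟨b, hb, hy⟩ := hv.exists_mem_segment hn
    have ha' : G.IsEndOf a x.1 := Or.inr ⟨u, ha.symm, segment_symm ℝ (bary u) (bary a) ▸ hx⟩
    have hb' : G.IsEndOf b y.1 := Or.inr ⟨v, hb.symm, segment_symm ℝ (bary v) (bary b) ▸ hy⟩
    obtain ⟨-, -, hx1, -⟩ := mem_seg ha.ne hx
    obtain ⟨-, -, hy1, -⟩ := mem_seg hb.ne hy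
    have hub := huv.trans hb.reachable
    have hav := ha.symm.reachable.trans huv
    have hab := hav.trans hb.reachable
    have p1 := c.even_dist_iff huv
    have p2 := c.even_dist_iff hub
    have p3 := c.even_dist_iff hav
    have p4 := c.even_dist_iff hab
    have ca := c.valid ha
    have cb := c.valid hb
    have d1 := hdist _ _ huv
    have d2 := hdist _ _ hub
    have d3 := hdist _ _ hav
    have d4 := hdist _ _ hab
    -- Of the four distances between ends of the two edges, `uv` and `ab` share one parity, `ub` and
    -- `av` the other. The pair whose parity differs from that of `k` is bounded by `k - 1`.
    have q : (Even (G.dist u v) ↔ Even (G.dist a b)) ∧ (Even (G.dist u b) ↔ Even (G.dist a v)) ∧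
        (Even (G.dist u v) ↔ ¬ Even (G.dist u b)) := by
      rw [p1, p2, p3, p4]
      revert ca cb
      cases c u <;> cases c v <;> cases c a <;> cases c b <;> simp
    simp only [Nat.even_iff] at q
    rw [← ENNReal.ofReal_natCast]
    obtain ⟨e1, e2⟩ | ⟨e1, e2⟩ : (G.dist u v + 1 ≤ k ∧ G.dist a b + 1 ≤ k) ∨
        (G.dist u b + 1 ≤ k ∧ G.dist a v + 1 ≤ k) := by omega
    · have e1' : (G.dist u v : ℝ) + 1 ≤ k := by exact_mod_cast e1
      have e2' : (G.dist a b : ℝ) + 1 ≤ k := by exact_mod_cast e2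
      -- The routes through `u, v` and through `a, b` use complementary parts of both edges, so
      -- their lengths sum to at most `2 + 2(k - 1) = 2k`, and one is at most `k`.
      by_cases h : 1 - x.1 u + G.dist u v + (1 - y.1 v) ≤ k
      · exact edist_le_of_isEndOf hu hv huv h
      · exact edist_le_of_isEndOf ha' hb' hab (by linarith)
    · have e1' : (G.dist u b : ℝ) + 1 ≤ k := by exact_mod_cast e1
      have e2' : (G.dist a v : ℝ) + 1 ≤ k := by exact_mod_cast e2
      by_cases h : 1 - x.1 u + G.dist u b + (1 - y.1 b) ≤ k
      · exact edist_le_of_isEndOf hu hb' hub h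
      · exact edist_le_of_isEndOf ha' hv hav (by linarith)
  · obtain ⟨a, b, hab, hx, hy⟩ : ∃ a b, G.Adj a b ∧ x.1 ∈ segment ℝ (bary a) (bary b) ∧
        y.1 ∈ segment ℝ (bary a) (bary b) := by
      by_contra! hcon
      exact hE (iInf_eq_top.2 fun a => iInf_eq_top.2 fun b => iInf_eq_top.2 fun h =>
        absurd h.2.2 (hcon a b h.1 h.2.1))
    refine (min_le_left _ _).trans ((edgeDist_le hab hx hy).trans ?_)
    obtain ⟨h1, h2, h3, -⟩ := mem_seg hab.ne hx
    obtain ⟨k1, k2, k3, -⟩ := mem_seg hab.ne hy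
    have hk1 : (1 : ℝ) ≤ k := by
      have := hdist a b hab.reachable
      rw [dist_eq_one_iff_adj.2 hab] at this
      exact_mod_cast this
    rw [← ENNReal.ofReal_natCast]
    exact ENNReal.ofReal_le_ofReal (abs_le.2 ⟨by linarith, by linarith⟩)

end MetricGraph

theorem hyperbolicityConst_le_half_of_coloring (c : G.Coloring Bool) (hn : ∀ u, ∃ a, G.Adj u a)
    {k : ℕ∞} (hk : ∀ u v, G.Reachable u v → G.edist u v ≤ k) :
    G.hyperbolicityConst ≤ (k : ℝ≥0∞) / 2 := by
  induction k using ENat.recTopCoe with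
  | top => simp [ENNReal.top_div]
  | coe k => exact hyperbolicityConst_le_half fun x y h =>
      (MetricGraph.edist_le_of_coloring c hn hk h).trans_eq (ENat.toENNReal_coe k).symm

end Bipartite

/-! ### Hyperbolicity of direct products -/

section DirectProd

variable {V₁ V₂ : Type*} {G₁ : SimpleGraph V₁} {G₂ : SimpleGraph V₂}

theorem hyperbolicityConst_le_of_leftInverse {V W : Type*} {G : SimpleGraph V}
    {H : SimpleGraph W} (f : G →g H) (g : H →g G) (hgf : ∀ v, g (f v) = v) :
    G.hyperbolicityConst ≤ H.hyperbolicityConst :=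
  hyperbolicityConst_le_of_isometry (MetricGraph.isometry_map_of_leftInverse f g hgf)

/-- An edge of `G₁` changes colour, so switching between `a` and `b` by colour lifts `G₁` to the
product, with the first projection as left inverse. -/
theorem hyperbolicityConst_le_directProd_left (c : G₁.Coloring Bool) {a b : V₂}
    (hab : G₂.Adj a b) : G₁.hyperbolicityConst ≤ (G₁.directProd G₂).hyperbolicityConst := by
  refine hyperbolicityConst_le_of_leftInverse ⟨fun u => (u, bif c u then a else b), ?_⟩
    (directProdFst G₁ G₂) fun _ => rfl
  intro u v huv
  refine ⟨huv, ?_⟩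
  have := c.valid huv
  cases hu : c u <;> cases hv : c v <;> simp_all [hab.symm]

theorem hyperbolicityConst_le_directProd_right (c : G₂.Coloring Bool) {a b : V₁}
    (hab : G₁.Adj a b) : G₂.hyperbolicityConst ≤ (G₁.directProd G₂).hyperbolicityConst := by
  refine hyperbolicityConst_le_of_leftInverse ⟨fun u => (bif c u then a else b, u), ?_⟩
    (directProdSnd G₁ G₂) fun _ => rfl
  intro u v huv
  refine ⟨?_, huv⟩
  have := c.valid huv
  cases hu : c u <;> cases hv : c v <;> simp_all [hab.symm]

theorem natCast_le_hyperbolicityConst_directProd (hc₁ : G₁.Connected) (hc₂ : G₂.Connected) {r : ℕ}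
    (h₁ : ((2 * r : ℕ) : ℕ∞) ≤ G₁.ediam) (h₂ : ((r + 1 : ℕ) : ℕ∞) ≤ G₂.ediam) :
    (r : ℝ≥0∞) ≤ (G₁.directProd G₂).hyperbolicityConst := by
  rcases Nat.eq_zero_or_pos r with rfl | hr
  · simp
  obtain ⟨g, hg, hgd⟩ := hc₁.exists_geodesic h₁
  obtain ⟨h, hh, hhd⟩ := hc₂.exists_geodesic h₂
  -- The second coordinate of `U` runs through `1, …, r + 1, …, 1` and that of `L` through `1, 0, …,
  -- 1`; starting at 1 makes the ends agree and places the summit `r + 1` at distance `r` or more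
  -- from `L`.
  let U : ℕ → V₁ × V₂ := fun i => (g i, h (if i ≤ r then i + 1 else 2 * r + 1 - i))
  let L : ℕ → V₁ × V₂ := fun i => (g i, h ((i + 1) % 2))
  have hh' : ∀ i j, (i + 1 = j ∧ j ≤ r + 1 ∨ j + 1 = i ∧ i ≤ r + 1) → G₂.Adj (h i) (h j) := by
    rintro i j (⟨rfl, hi⟩ | ⟨rfl, hi⟩)
    · exact hh i (by omega)
    · exact (hh j (by omega)).symm
  have hU : ∀ i < 2 * r, (G₁.directProd G₂).Adj (U i) (U (i + 1)) := fun i hi =>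
    ⟨hg i hi, hh' _ _ (by split_ifs <;> omega)⟩
  have hL : ∀ i < 2 * r, (G₁.directProd G₂).Adj (L i) (L (i + 1)) := fun i hi =>
    ⟨hg i hi, hh' _ _ (by omega)⟩
  -- The first coordinate already forces `2r` steps, so both walks are geodesics whatever their
  -- second coordinates.
  have hd : ∀ a b : V₂, ((2 * r : ℕ) : ℕ∞) ≤ (G₁.directProd G₂).edist (g 0, a) (g (2 * r), b) :=
    fun a b => (hgd 0 (Nat.zero_le _) (2 * r) le_rfl (Nat.zero_le _)).symm.le.trans
      (edist_map_le (directProdFst G₁ G₂) (g 0, a) (g (2 * r), b))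
  obtain ⟨S, hS, hSv, -⟩ := MetricGraph.exists_isGeodesicBetween hU (by omega) (hd _ _)
  obtain ⟨S', hS', -, hSs⟩ := MetricGraph.exists_isGeodesicBetween hL (by omega) (hd _ _)
  have h0 : U 0 = L 0 := by simp [U, L]
  have h2r : U (2 * r) = L (2 * r) := by
    have e1 : ¬ 2 * r ≤ r := by omega
    have e2 : 2 * r + 1 - 2 * r = 1 := by omega
    have e3 : (2 * r + 1) % 2 = 1 := by omega
    simp [U, L, e1, e2, e3]
  rw [← h0, ← h2r] at hS'
  refine le_hyperbolicityConst_of_bigon hS hS' (hSv r (by omega)) fun q hq => ?_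
  obtain ⟨i, hi, hq⟩ := hSs q hq
  have hfar : ∀ j, (r : ℕ∞) ≤ (G₁.directProd G₂).edist (U r) (L j) := fun j => by
    have hj : (j + 1) % 2 ≤ 1 := by omega
    have e : G₂.edist (h (r + 1)) (h ((j + 1) % 2)) = (r + 1 - (j + 1) % 2 : ℕ) := by
      rw [SimpleGraph.edist_comm]
      exact hhd _ (by omega) _ le_rfl (by omega)
    have e' : (r : ℕ∞) ≤ (r + 1 - (j + 1) % 2 : ℕ) := by
      exact_mod_cast (show r ≤ r + 1 - (j + 1) % 2 by omega)
    refine e'.trans (e.symm.le.trans ?_)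
    simpa [U, L, directProdSnd] using edist_map_le (directProdSnd G₁ G₂) (U r) (L j)
  exact_mod_cast MetricGraph.le_edist_vert_of_mem_segment (hL i hi) hq (hfar i) (hfar (i + 1))

/-- The bigon is used with `r = min(⌊k₁/2⌋, k₂ - 1)`, and `⌊k₁/2⌋ ≥ (k₁ - 1)/2`. If both diameters
are infinite, every `r` is allowed. -/
theorem min_le_hyperbolicityConst_directProd (hc₁ : G₁.Connected) (hc₂ : G₂.Connected)
    (h21 : G₂.ediam ≤ G₁.ediam) (h2 : 1 ≤ G₂.ediam) :
    min (((G₁.ediam : ℝ≥0∞) - 1) / 2) ((G₂.ediam : ℝ≥0∞) - 1) ≤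
      (G₁.directProd G₂).hyperbolicityConst := by
  have key := fun r : ℕ => natCast_le_hyperbolicityConst_directProd (r := r) hc₁ hc₂
  generalize (G₁.directProd G₂).hyperbolicityConst = δ at *
  generalize G₁.ediam = k₁ at *
  generalize G₂.ediam = k₂ at *
  induction k₂ using ENat.recTopCoe with
  | top =>
    obtain rfl := top_le_iff.1 h21
    refine le_of_le_of_eq le_top (Eq.symm (ENNReal.eq_top_of_forall_nnreal_le fun x => ?_))
    obtain ⟨r, hr⟩ := exists_nat_ge x
    exact le_trans (by exact_mod_cast hr) (key r le_top le_top)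
  | coe m =>
    have hm : 1 ≤ m := by exact_mod_cast h2
    by_cases hmk : ((2 * (m - 1) : ℕ) : ℕ∞) ≤ k₁
    · refine (min_le_right _ _).trans (le_trans (le_of_eq ?_) (key (m - 1) hmk ?_))
      · simp
      · exact_mod_cast (show m - 1 + 1 ≤ m by omega)
    · induction k₁ using ENat.recTopCoe with
      | top => exact absurd le_top hmk
      | coe n =>
        have hmk' : ¬ 2 * (m - 1) ≤ n := by exact_mod_cast hmk
        refine (min_le_left _ _).trans (le_trans ?_ (key (n / 2) ?_ ?_))
        · rw [ENNReal.div_le_iff (by norm_num) (by norm_num), tsub_le_iff_right,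
            ENat.toENNReal_coe]
          exact_mod_cast (show n ≤ n / 2 * 2 + 1 by omega)
        · exact_mod_cast (show 2 * (n / 2) ≤ n by omega)
        · exact_mod_cast (show n / 2 + 1 ≤ m by omega)

theorem half_le_hyperbolicityConst_directProd (hc₁ : G₁.Connected) (hc₂ : G₂.Connected)
    (h21 : G₂.ediam ≤ G₁.ediam) (h2 : 1 ≤ G₂.ediam) {n : ℕ} (hn : G₁.ediam = n) (he : Even n)
    (hle : G₁.ediam ≤ 2 * G₂.ediam - 2) :
    (G₁.ediam : ℝ≥0∞) / 2 ≤ (G₁.directProd G₂).hyperbolicityConst := by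
  obtain ⟨r, rfl⟩ := he
  have key := natCast_le_hyperbolicityConst_directProd (r := r) hc₁ hc₂
  rw [hn] at h21 hle key ⊢
  generalize G₂.ediam = k₂ at *
  lift k₂ to ℕ using ne_top_of_le_ne_top (ENat.natCast_ne_top _) h21
  have h2' : 1 ≤ k₂ := by exact_mod_cast h2
  -- As `k₂ ≥ 1`, the truncated subtraction is the true one, and `r + 1 ≤ k₂` follows.
  have hle' : r + r ≤ 2 * k₂ - 2 := by exact_mod_cast hle
  refine le_trans (le_of_eq ?_) (key ?_ ?_)
  · rw [← two_mul, ENat.toENNReal_coe, Nat.cast_mul, mul_comm, Nat.cast_ofNat,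
      ENNReal.mul_div_cancel_right (by norm_num) (by norm_num)]
  · exact_mod_cast (show 2 * r ≤ r + r by omega)
  · exact_mod_cast (show r + 1 ≤ k₂ by omega)

theorem IsBipartite.exists_coloring_bool {V : Type*} {G : SimpleGraph V} (h : G.IsBipartite) :
    Nonempty (G.Coloring Bool) :=
  ⟨recolorOfEquiv G finTwoEquiv h.some⟩

end DirectProd

end SimpleGraph

/-! ### Assembly of the bounds. -/

theorem mainTheorem9 {V₁ V₂ : Type*} (G₁ : SimpleGraph V₁) (G₂ : SimpleGraph V₂)
    (hc₁ : G₁.Connected) (hc₂ : G₂.Connected)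
    (hb₁ : G₁.IsBipartite) (hb₂ : G₂.IsBipartite)
    (h21 : G₂.ediam ≤ G₁.ediam) (h2 : 1 ≤ G₂.ediam) :
    max (min (((G₁.ediam : ℝ≥0∞) - 1) / 2) ((G₂.ediam : ℝ≥0∞) - 1))
        (max G₁.hyperbolicityConst G₂.hyperbolicityConst)
      ≤ (G₁.directProd G₂).hyperbolicityConst ∧
    (G₁.directProd G₂).hyperbolicityConst ≤ (G₁.ediam : ℝ≥0∞) / 2 ∧
    (∀ n : ℕ, G₁.ediam = n → Even n → G₁.ediam ≤ 2 * G₂.ediam - 2 →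
      (G₁.directProd G₂).hyperbolicityConst = (G₁.ediam : ℝ≥0∞) / 2) := by
  obtain ⟨c₁⟩ := hb₁.exists_coloring_bool
  obtain ⟨c₂⟩ := hb₂.exists_coloring_bool
  -- A nonzero diameter rules out one-vertex factors, so by connectedness every vertex has a
  -- neighbour, as the padding and the colour sections require.
  have : Nontrivial V₁ := SimpleGraph.nontrivial_of_ediam_ne_zero
    (zero_lt_one.trans_le (h2.trans h21)).ne'
  have : Nontrivial V₂ := SimpleGraph.nontrivial_of_ediam_ne_zero (zero_lt_one.trans_le h2).ne'
  have hn₁ := hc₁.preconnected.exists_adj_of_nontrivial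
  have hn₂ := hc₂.preconnected.exists_adj_of_nontrivial
  obtain ⟨u₁⟩ := hc₁.nonempty
  obtain ⟨u₂⟩ := hc₂.nonempty
  obtain ⟨a₁, h₁⟩ := hn₁ u₁
  obtain ⟨a₂, h₂⟩ := hn₂ u₂
  have upper : (G₁.directProd G₂).hyperbolicityConst ≤ (G₁.ediam : ℝ≥0∞) / 2 := by
    refine SimpleGraph.hyperbolicityConst_le_half_of_coloring
      (c₁.comp (SimpleGraph.directProdFst G₁ G₂)) (fun u => ?_) fun u v huv => ?_
    · obtain ⟨a, ha⟩ := hn₁ u.1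
      obtain ⟨b, hb⟩ := hn₂ u.2
      exact ⟨(a, b), ha, hb⟩
    · exact SimpleGraph.edist_directProd_le c₁ c₂ hn₁ hn₂ huv SimpleGraph.edist_le_ediam
        (SimpleGraph.edist_le_ediam.trans h21)
  refine ⟨max_le (SimpleGraph.min_le_hyperbolicityConst_directProd hc₁ hc₂ h21 h2)
    (max_le (SimpleGraph.hyperbolicityConst_le_directProd_left c₁ h₂)
      (SimpleGraph.hyperbolicityConst_le_directProd_right c₂ h₁)), upper, fun n hn he hle => ?_⟩
  exact le_antisymm upper
    (SimpleGraph.half_le_hyperbolicityConst_directProd hc₁ hc₂ h21 h2 hn he hle)
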